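/- **Proposition 3.1.** Let $G$ be a countable discrete group and $H<G$ an abelian subgroup such that for every $g\in G\setminus H$ the set $\{hgh^{-1} : h\in H\}$ is infinite. Let $C\subset G$ be a system of representatives of the left cosets $gH$ with $1\in C$, and let $\sigma:G\to C$ and $\eta:G\to H$ be the maps determined by $g=\sigma(g)\eta(g)$ for all $g\in G$. For a character $t$ of $H$ (a group homomorphism from $H$ to the unit circle), let $\pi_t$ be the unitary representation of $G$ on $\ell^2(C)$, with standard orthonormal basis $(\varepsilon_c)_{c\in C}$, given by $$\pi_t(g)\varepsilon_c=t(\eta(gc))\,\varepsilon_{\sigma(gc)},\qquad g\in G,\ c\in C.$$ 1. For any two characters $s,t$ of $H$, the representations $\pi_s$ and $\pi_t$ of $G$ are unitarily equivalent if and only if their restrictions $\pi_s|_H$ and $\pi_t|_H$ to $H$ are unitarily equivalent. 2. Let $\lambda$ be the left regular representation of $G$ on $\ell^2(G)$, let $M=L(G)=\lambda(G)''$ and $A=L(H)=\lambda(H)''\subset M$, let $N_G(H)=\{g\in G : gHg^{-1}=H\}$, and let $N_M(A)$ be the group of unitaries $u\in M$ with $uAu^*=A$. Then $\lambda(N_G(H))$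 and $N_M(A)$ generate the same von Neumann algebra: $$\lambda(N_G(H))''=N_M(A)''.$$ -/

import Mathlib

noncomputable section

namespace MasaGroup

open scoped ENNReal

/-- The Hilbert space `ℓ²(I)` of square summable complex valued functions on `I`. -/
abbrev L2 (I : Type*) : Type _ := lp (fun _ : I => ℂ) 2

/-- The vector `δ_i` of the standard orthonormal basis of `ℓ²(I)`. -/
def basisVec {I : Type*} (i : I) : L2 I :=
  open Classical in lp.single 2 i (1 : ℂ)

section Monomial

variable {I : Type*}

lemma summable_norm_sq (f : L2 I) : Summable fun i => ‖f i‖ ^ (2 : ℝ≥0∞).toReal :=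
  (lp.memℓp f).summable (by norm_num)

/-- The linear map `ℓ²(I) → ℓ²(I)` given by `f ↦ (j ↦ a (e⁻¹ j) f (e⁻¹ j))`. -/
def monomialLinear (e : Equiv.Perm I) (a : I → Circle) : L2 I →ₗ[ℂ] L2 I where
  toFun f := ⟨fun j => (a (e.symm j) : ℂ) * f (e.symm j), by
    refine memℓp_gen ?_
    simpa [Circle.norm_coe, Function.comp_def] using
      (e.symm.summable_iff).2 (summable_norm_sq f)⟩
  map_add' f g := by
    ext j
    exact mul_add _ _ _
  map_smul' c f := by
    ext j
    simp [mul_left_comm]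

@[simp]
lemma monomialLinear_apply (e : Equiv.Perm I) (a : I → Circle) (f : L2 I) (j : I) :
    monomialLinear e a f j = (a (e.symm j) : ℂ) * f (e.symm j) := rfl

/-- The unitary operator of `ℓ²(I)` with `δ_i ↦ a_i δ_{e(i)}`, for a permutation `e` of `I` and
complex numbers `a_i` of modulus one (see `monomial_basisVec`). -/
def monomial (e : Equiv.Perm I) (a : I → Circle) : L2 I ≃ₗᵢ[ℂ] L2 I where
  toLinearEquiv := LinearEquiv.ofLinearMap (monomialLinear e a)
    (monomialLinear e.symm fun j => (a (e.symm j))⁻¹)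
    (by
      ext f j
      simp)
    (by
      ext f j
      simp)
  norm_map' f := by
    have h : (0 : ℝ) < (2 : ℝ≥0∞).toReal := by norm_num
    change ‖monomialLinear e a f‖ = ‖f‖
    rw [lp.norm_eq_tsum_rpow h, lp.norm_eq_tsum_rpow h]
    congr 1
    rw [← e.symm.tsum_eq fun i => ‖f i‖ ^ (2 : ℝ≥0∞).toReal]
    simp [Circle.norm_coe]

@[simp]
lemma monomial_apply (e : Equiv.Perm I) (a : I → Circle) (f : L2 I) (j : I) :
    monomial e a f j = (a (e.symm j) : ℂ) * f (e.symm j) := rfl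

lemma monomial_basisVec (e : Equiv.Perm I) (a : I → Circle) (i : I) :
    monomial e a (basisVec i) = (a i : ℂ) • basisVec (e i) := by
  classical
  ext j
  simp only [monomial_apply, basisVec, lp.coeFn_smul, Pi.smul_apply, smul_eq_mul]
  by_cases h : j = e i
  · subst h
    simp [lp.single_apply]
  · have h' : e.symm j ≠ i := fun h' => h (by simp [← h'])
    simp [lp.single_apply, h, h']

end Monomial

/-- Two unitary representations of a group `K` are unitarily equivalent: some unitary operator
intertwines them. -/
def UnitarilyEquivalent {K E F : Type*} [Group K]
    [NormedAddCommGroup E] [InnerProductSpace ℂ E] [NormedAddCommGroup F] [InnerProductSpace ℂ F]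
    (ρ : K →* (E ≃ₗᵢ[ℂ] E)) (ρ' : K →* (F ≃ₗᵢ[ℂ] F)) : Prop :=
  ∃ U : E ≃ₗᵢ[ℂ] F, ∀ (k : K) (x : E), U (ρ k x) = ρ' k (U x)

section Induced

variable {G : Type*} [Group G] {H : Subgroup G} {C : Set G}

/-- For a system `C` of representatives of the left cosets `gH`, the element `σ(g)` of `C` in the
factorization `g = σ(g) η(g)`. -/
def sigma (hC : Subgroup.IsComplement C (H : Set G)) (g : G) : C := (hC.equiv g).1

/-- The element `η(g)` of `H` in the factorization `g = σ(g) η(g)`. -/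
def eta (hC : Subgroup.IsComplement C (H : Set G)) (g : G) : H := (hC.equiv g).2

variable (hC : Subgroup.IsComplement C (H : Set G))

lemma sigma_mul_eta (g : G) : (sigma hC g : G) * (eta hC g : G) = g :=
  hC.equiv_fst_mul_equiv_snd g

lemma sigma_mul_mem (g : G) (h : H) : sigma hC (g * h) = sigma hC g := by
  simp [sigma, hC.equiv_mul_right g h]

lemma eta_mul_mem (g : G) (h : H) : eta hC (g * h) = eta hC g * h := by
  simp [eta, hC.equiv_mul_right g h]

lemma sigma_coe (c : C) : sigma hC (c : G) = c :=
  Subtype.ext ((hC.equiv_fst_eq_self_iff_mem H.one_mem).2 c.2)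

lemma sigma_mul_sigma (g x : G) : sigma hC (g * sigma hC x) = sigma hC (g * x) := by
  rw [← sigma_mul_mem hC (g * sigma hC x) (eta hC x), mul_assoc, sigma_mul_eta]

lemma eta_mul_eta (g x : G) : eta hC (g * sigma hC x) * eta hC x = eta hC (g * x) := by
  rw [← eta_mul_mem, mul_assoc, sigma_mul_eta]

/-- The permutation `c ↦ σ(gc)` of `C`. -/
def cosetPerm (g : G) : Equiv.Perm C where
  toFun c := sigma hC (g * c)
  invFun c := sigma hC (g⁻¹ * c)
  left_inv c := by simp [sigma_mul_sigma, sigma_coe]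
  right_inv c := by simp [sigma_mul_sigma, sigma_coe]

/-- The unitary representation `π_t` of `G` on `ℓ²(C)` attached to a character `t` of `H`:
`π_t(g) δ_c = t(η(gc)) δ_{σ(gc)}`. -/
def inducedRep (t : H →* Circle) : G →* (L2 C ≃ₗᵢ[ℂ] L2 C) where
  toFun g := monomial (cosetPerm hC g) fun c => t (eta hC (g * c))
  map_one' := by
    ext f j
    have h : (cosetPerm hC 1).symm j = j := by simp [cosetPerm, sigma_coe]
    have h' : eta hC (j : G) = 1 := by
      have := sigma_mul_eta hC (j : G)
      rw [sigma_coe] at this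
      exact Subtype.ext (by simpa using this)
    simp [h, h']
  map_mul' g g' := by
    ext f j
    obtain ⟨i, rfl⟩ : ∃ i, cosetPerm hC g (cosetPerm hC g' i) = j :=
      ⟨(cosetPerm hC g').symm ((cosetPerm hC g).symm j), by simp⟩
    have h : cosetPerm hC g (cosetPerm hC g' i) = cosetPerm hC (g * g') i := by
      simp [cosetPerm, sigma_mul_sigma, mul_assoc]
    have h' : eta hC (g * g' * i) = eta hC (g * cosetPerm hC g' i) * eta hC (g' * i) := by
      simp [cosetPerm, eta_mul_eta, mul_assoc]
    simp only [LinearIsometryEquiv.coe_mul, Function.comp_apply, monomial_apply,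
      Equiv.symm_apply_apply]
    rw [h, Equiv.symm_apply_apply, h', map_mul, Circle.coe_mul, mul_assoc]

lemma inducedRep_basisVec (t : H →* Circle) (g : G) (c : C) :
    inducedRep hC t g (basisVec c) =
      (t (eta hC (g * c)) : ℂ) • basisVec (sigma hC (g * c)) :=
  monomial_basisVec _ _ c

end Induced

section VonNeumann

/-- The von Neumann algebra generated by a set `S` of bounded operators: the bicommutant of
`S ∪ S*`. -/
def generatedBy {E : Type*} [NormedAddCommGroup E] [InnerProductSpace ℂ E] [CompleteSpace E]
    (S : Set (E →L[ℂ] E)) : VonNeumannAlgebra E where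
  toStarSubalgebra :=
    StarSubalgebra.centralizer ℂ (StarSubalgebra.centralizer ℂ S : Set (E →L[ℂ] E))
  centralizer_centralizer' := by simp

lemma coe_generatedBy {E : Type*} [NormedAddCommGroup E] [InnerProductSpace ℂ E] [CompleteSpace E]
    (S : Set (E →L[ℂ] E)) :
    (generatedBy S : Set (E →L[ℂ] E)) = Set.centralizer (Set.centralizer (S ∪ star S)) :=
  StarSubalgebra.coe_centralizer_centralizer ℂ S

/-- The normalizer `N_M(A)`: the unitaries `u ∈ M` such that `u A u* = A`. -/
def vnNormalizer {E : Type*} [NormedAddCommGroup E] [InnerProductSpace ℂ E] [CompleteSpace E]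
    (M A : VonNeumannAlgebra E) : Set (E →L[ℂ] E) :=
  {u | u ∈ M ∧ u ∈ unitary (E →L[ℂ] E) ∧
    (fun a : E →L[ℂ] E => u * a * star u) '' (A : Set (E →L[ℂ] E)) = (A : Set (E →L[ℂ] E))}

/-- The operator `λ(g)` of the left regular representation on `ℓ²(G)`: `λ(g) δ_x = δ_{gx}`. -/
def leftReg {G : Type*} [Group G] (g : G) : L2 G →L[ℂ] L2 G :=
  ((monomial (Equiv.mulLeft g) fun _ => 1).toContinuousLinearEquiv : L2 G →L[ℂ] L2 G)

lemma leftReg_basisVec {G : Type*} [Group G] (g x : G) :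
    leftReg g (basisVec x) = basisVec (g * x) := by
  have h := monomial_basisVec (Equiv.mulLeft g) (fun _ => 1) x
  rw [Circle.coe_one, one_smul] at h
  exact h

/-- The group von Neumann algebra `L(G)`, acting on `ℓ²(G)`. -/
def groupVN (G : Type*) [Group G] : VonNeumannAlgebra (L2 G) :=
  generatedBy (Set.range (leftReg : G → L2 G →L[ℂ] L2 G))

/-- The von Neumann algebra `L(H)` of a subgroup `H` of `G`, as a subalgebra of `L(G)`. -/
def subgroupVN {G : Type*} [Group G] (H : Subgroup G) : VonNeumannAlgebra (L2 G) :=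
  generatedBy (leftReg '' (H : Set G))

end VonNeumann

end MasaGroup

end

noncomputable section

namespace MasaGroup

/-! ### Finite orbits on left cosets, and the induced representations -/

section Cosets

variable {G : Type*} [Group G] {H : Subgroup G} {C : Set G}
  (hC : Subgroup.IsComplement C (H : Set G))

/-! Both parts rest on one finiteness argument (`mem_normalizer_of_summable`). If a summable
function on G/H is H-invariant and positive at cH, then the H-orbit of cH is finite. For k in H the
element ckc⁻¹ depends only on cH, since H is abelian, so it has finitely many H-conjugates and lies
in H by hypothesis. Hence cHc⁻¹ ⊆ H, and the hypothesis upgrades this to c normalizing H.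

For the representations, an intertwiner over H sends ε_1 to an eigenvector f of π_t restricted to H,
with character s. Then |f|² is invariant, so f lives on the normalizer, and a point c of its support
gives s(h) = t(c⁻¹hc). Right translation by c, twisted by t, then intertwines all of G.

For the algebras, the invariant function is the mass on each coset xH of the Fourier coefficients of
a unitary u normalizing L(H) (`tsum_coset_mul_left`). So these coefficients are supported on N_G(H),
which puts u in L(N_G(H)) (`mem_subgroupVN_of_support`). -/

lemma eta_coe (c : C) : eta hC (c : G) = 1 := by
  have := sigma_mul_eta hC (c : G)
  rw [sigma_coe] at this
  exact Subtype.ext (by simpa using this)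

/-- If every `g ∉ H` has infinitely many conjugates under the abelian subgroup `H`, then
`c H c⁻¹ ⊆ H` implies that `c` normalizes `H`. -/
lemma mem_normalizer_of_conj_mem (hH : ∀ x ∈ H, ∀ y ∈ H, x * y = y * x)
    (hICC : ∀ g : G, g ∉ H → {x : G | ∃ h ∈ H, x = h * g * h⁻¹}.Infinite) {c : G}
    (hc : ∀ k ∈ H, c * k * c⁻¹ ∈ H) : c ∈ Subgroup.normalizer (H : Set G) := by
  rw [Subgroup.mem_normalizer_iff]
  refine fun k => ⟨hc k, fun hk => ?_⟩
  by_contra hkH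
  refine hICC k hkH ((Set.finite_singleton k).subset ?_)
  rintro _ ⟨h, hh, rfl⟩
  -- Both chc⁻¹ and ckc⁻¹ lie in the abelian group H, so h commutes with k and k is its own only
  -- H-conjugate.
  have e := hH _ (hc h hh) _ hk
  have e' : c * (h * k) * c⁻¹ = c * (k * h) * c⁻¹ := by simpa [mul_assoc] using e
  have e'' : h * k = k * h := mul_left_cancel (mul_right_cancel e')
  simp [e'']

/-- A summable function on `G / H` that is invariant under the left action of `H` is supported on
the normalizer of `H`. -/
lemma mem_normalizer_of_summable (hH : ∀ x ∈ H, ∀ y ∈ H, x * y = y * x)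
    (hICC : ∀ g : G, g ∉ H → {x : G | ∃ h ∈ H, x = h * g * h⁻¹}.Infinite)
    {w : C → ℝ} (hw : Summable w) (hinv : ∀ h ∈ H, ∀ c : C, w (sigma hC (h * c)) = w c)
    {c : C} (hc : 0 < w c) : (c : G) ∈ Subgroup.normalizer (H : Set G) := by
  have hfin : {d : C | w c ≤ w d}.Finite := by
    have := hw.tendsto_cofinite_zero.eventually_lt_const hc
    simpa [Filter.eventually_cofinite] using this
  refine mem_normalizer_of_conj_mem hH hICC fun k hk => ?_
  by_contra hx
  refine hICC _ hx ((hfin.image fun d : C => (d : G) * k * (d : G)⁻¹).subset ?_)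
  rintro _ ⟨h, hh, rfl⟩
  refine ⟨sigma hC (h * c), (hinv h hh c).ge, ?_⟩
  -- The conjugate of k by hc depends only on the coset hcH, because H is abelian.
  have key (d : G) (m : H) (e : d * m = h * c) : d * k * d⁻¹ = h * (c * k * (c : G)⁻¹) * h⁻¹ := by
    have hm : (m : G) * k * (m : G)⁻¹ = k := by rw [hH _ m.2 _ hk]; simp
    calc d * k * d⁻¹ = d * (m * k * (m : G)⁻¹) * d⁻¹ := by rw [hm]
      _ = (d * m) * k * (d * m)⁻¹ := by group
      _ = h * (c * k * (c : G)⁻¹) * h⁻¹ := by rw [e]; group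
  exact key _ _ (sigma_mul_eta hC (h * c))

lemma mul_normalizer_eq {n : G} (x : G) (h : H) :
    x * h * n = x * n * (n⁻¹ * h * n) := by group

/-- Right multiplication by n descends to left cosets because n⁻¹Hn = H. -/
lemma sigma_sigma_mul {n : G} (hn : n ∈ Subgroup.normalizer (H : Set G)) (x : G) :
    sigma hC (sigma hC x * n) = sigma hC (x * n) := by
  conv_rhs => rw [← sigma_mul_eta hC x, mul_normalizer_eq]
  exact (sigma_mul_mem hC _
    ⟨_, (Subgroup.mem_normalizer_iff''.1 hn _).1 (eta hC x).2⟩).symm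

lemma eta_sigma_mul {n : G} (hn : n ∈ Subgroup.normalizer (H : Set G)) (x : G) :
    eta hC (x * n) = eta hC (sigma hC x * n) *
      ⟨n⁻¹ * eta hC x * n, (Subgroup.mem_normalizer_iff''.1 hn _).1 (eta hC x).2⟩ := by
  conv_lhs => rw [← sigma_mul_eta hC x, mul_normalizer_eq]
  exact eta_mul_mem hC _ ⟨_, (Subgroup.mem_normalizer_iff''.1 hn _).1 (eta hC x).2⟩

/-- The permutation `c ↦ σ(cn)` of `C` attached to an element `n` normalizing `H`. -/
def rightCosetPerm {n : G} (hn : n ∈ Subgroup.normalizer (H : Set G)) : Equiv.Perm C where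
  toFun c := sigma hC (c * n)
  invFun c := sigma hC (c * n⁻¹)
  left_inv c := by
    change sigma hC (sigma hC (c * n) * n⁻¹) = c
    rw [sigma_sigma_mul hC (inv_mem hn), mul_inv_cancel_right, sigma_coe]
  right_inv c := by
    change sigma hC (sigma hC (c * n⁻¹) * n) = c
    rw [sigma_sigma_mul hC hn, inv_mul_cancel_right, sigma_coe]

lemma monomial_comp {I : Type*} (e e' : Equiv.Perm I) (a a' : I → Circle) (f : L2 I) :
    monomial e a (monomial e' a' f) = monomial (e'.trans e) (fun i => a (e' i) * a' i) f := by
  ext j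
  simp [mul_assoc]

/-- Characters conjugate under the normalizer of `H` induce equivalent representations. -/
lemma unitarilyEquivalent_inducedRep_of_conj {s t : H →* Circle} {n : G}
    (hn : n ∈ Subgroup.normalizer (H : Set G))
    (hst : ∀ h : H, s h = t ⟨n⁻¹ * h * n, (Subgroup.mem_normalizer_iff''.1 hn _).1 h.2⟩) :
    UnitarilyEquivalent (inducedRep hC s) (inducedRep hC t) := by
  -- Right translation by n commutes with the left action of G; the factor t(η(cn)) accounts for the
  -- return to the representative σ(cn).
  refine ⟨monomial (rightCosetPerm hC hn) fun c => t (eta hC (c * n)), fun g f => ?_⟩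
  change monomial _ _ (monomial _ _ f) = monomial _ _ (monomial _ _ f)
  rw [monomial_comp, monomial_comp]
  congr 2
  · ext c
    simp [cosetPerm, rightCosetPerm, sigma_sigma_mul hC hn, sigma_mul_sigma, mul_assoc]
  · funext c
    simp only [cosetPerm, rightCosetPerm, Equiv.coe_fn_mk]
    -- Both coefficients equal t(η(gcn)).
    rw [hst, ← map_mul, ← map_mul, ← eta_sigma_mul hC hn, eta_mul_eta, mul_assoc]

/-- An equivalence of the restrictions to `H` conjugates the characters under the normalizer. -/
lemma exists_conj_of_unitarilyEquivalent (hH : ∀ x ∈ H, ∀ y ∈ H, x * y = y * x)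
    (hICC : ∀ g : G, g ∉ H → {x : G | ∃ h ∈ H, x = h * g * h⁻¹}.Infinite)
    (h1 : (1 : G) ∈ C) {s t : H →* Circle}
    (hU : UnitarilyEquivalent ((inducedRep hC s).comp H.subtype)
      ((inducedRep hC t).comp H.subtype)) :
    ∃ (n : G) (hn : n ∈ Subgroup.normalizer (H : Set G)),
      ∀ h : H, s h = t ⟨n⁻¹ * h * n, (Subgroup.mem_normalizer_iff''.1 hn _).1 h.2⟩ := by
  obtain ⟨U, hU⟩ := hU
  set f : L2 C := U (basisVec ⟨1, h1⟩) with hf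
  have hσ (h : H) : sigma hC (h : G) = ⟨1, h1⟩ := by
    have := sigma_mul_mem hC 1 h
    rw [one_mul] at this
    rw [this]
    exact sigma_coe hC ⟨1, h1⟩
  have hη (h : H) : eta hC (h : G) = h := by
    have := eta_mul_mem hC 1 h
    rw [one_mul] at this
    rw [this, show eta hC (1 : G) = 1 from eta_coe hC ⟨1, h1⟩, one_mul]
  have heig (h : H) : inducedRep hC t h f = (s h : ℂ) • f := by
    have := hU h (basisVec ⟨1, h1⟩)
    simp only [MonoidHom.comp_apply, Subgroup.subtype_apply, inducedRep_basisVec, mul_one, hσ,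
      hη, map_smul] at this
    exact this.symm
  have hcoord (h : H) (c : C) :
      (t (eta hC (h * c)) : ℂ) * f c = s h * f (sigma hC (h * c)) := by
    have := congrArg (fun v : L2 C => v (cosetPerm hC h c)) (heig h)
    change (t (eta hC (h * (cosetPerm hC h).symm (cosetPerm hC h c))) : ℂ) *
      f ((cosetPerm hC h).symm (cosetPerm hC h c)) = _ at this
    rw [Equiv.symm_apply_apply] at this
    exact this
  have hf0 : f ≠ 0 := by
    intro h0
    have h0' : basisVec (⟨1, h1⟩ : C) = 0 := by simpa [hf] using h0
    have := congrArg (fun v : L2 C => v ⟨1, h1⟩) h0'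
    simp [basisVec] at this
  obtain ⟨c, hc⟩ : ∃ c, f c ≠ 0 := by
    by_contra! h
    exact hf0 (by ext c; simpa using h c)
  have hcN : (c : G) ∈ Subgroup.normalizer (H : Set G) := by
    -- Characters have modulus one, so `hcoord` makes |f| invariant under H.
    refine mem_normalizer_of_summable hC hH hICC (summable_norm_sq f) (fun h hh d => ?_)
      (c := c) (by positivity)
    have := congrArg norm (hcoord ⟨h, hh⟩ d)
    simp only [norm_mul, Circle.norm_coe, one_mul] at this
    simp only [this]
  refine ⟨c, hcN, fun h => ?_⟩
  -- Since c normalizes H, left multiplication by h fixes the coset cH, and `hcoord` at c compares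
  -- two multiples of f(c) ≠ 0.
  have hmul : (h : G) * c = c * ((⟨(c : G)⁻¹ * h * c,
    (Subgroup.mem_normalizer_iff''.1 hcN _).1 h.2⟩ : H) : G) := by simp [mul_assoc]
  have := hcoord h c
  rw [hmul, eta_mul_mem, sigma_mul_mem, sigma_coe, eta_coe, one_mul] at this
  exact (Circle.ext (mul_right_cancel₀ hc this)).symm

end Cosets

end MasaGroup

namespace MasaGroup

/-! ### Matrix coefficients of operators on ℓ²(I) -/

section Coordinates

variable {I : Type*}

lemma basisVec_apply [DecidableEq I] (i j : I) :
    (basisVec i : L2 I) j = if j = i then 1 else 0 := by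
  by_cases h : j = i
  · subst h; simp [basisVec]
  · simp [basisVec, h]

lemma inner_basisVec_left (i : I) (f : L2 I) : inner ℂ (basisVec i) f = f i := by
  classical
  exact (lp.inner_single_left (𝕜 := ℂ) (G := fun _ : I => ℂ) i 1 f).trans (by simp)

lemma hasSum_basisVec (f : L2 I) : HasSum (fun i => f i • (basisVec i : L2 I)) f := by
  classical
  convert lp.hasSum_single (by norm_num : (2 : ENNReal) ≠ ⊤) f using 2 with i
  ext j
  rw [lp.coeFn_smul, Pi.smul_apply, basisVec_apply, lp.single_apply]
  by_cases h : j = i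
  · subst h; simp
  · simp [h]

lemma clm_ext_basisVec {S T : L2 I →L[ℂ] L2 I} (h : ∀ i, S (basisVec i) = T (basisVec i)) :
    S = T := by
  ext1 f
  have hS := (hasSum_basisVec f).mapL S
  have hT := (hasSum_basisVec f).mapL T
  simp only [map_smul, h] at hS hT
  exact hS.unique hT

lemma hasSum_clm_apply (S : L2 I →L[ℂ] L2 I) (f : L2 I) (x : I) :
    HasSum (fun i => f i * S (basisVec i) x) (S f x) := by
  have h := ((hasSum_basisVec f).mapL S).mapL (innerSL ℂ (basisVec x))
  simpa [inner_basisVec_left] using h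

lemma star_apply_basisVec (S : L2 I →L[ℂ] L2 I) (i j : I) :
    star S (basisVec i) j = starRingEnd ℂ (S (basisVec j) i) := by
  rw [← inner_basisVec_left, ContinuousLinearMap.star_eq_adjoint,
    ContinuousLinearMap.adjoint_inner_right, ← inner_conj_symm, inner_basisVec_left]

open Classical in
/-- Multiplication of square summable functions by the indicator function of a set. -/
def truncate (s : Set I) : L2 I →L[ℂ] L2 I :=
  LinearMap.mkContinuous
    { toFun f := ⟨fun i => if i ∈ s then f i else 0,
        (lp.memℓp f).mono' fun i => by split_ifs <;> simp⟩
      map_add' f g := by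
        ext i
        change (if i ∈ s then f i + g i else 0) =
          (if i ∈ s then f i else 0) + (if i ∈ s then g i else 0)
        split_ifs <;> simp
      map_smul' c f := by
        ext i
        change (if i ∈ s then c * f i else 0) = c * (if i ∈ s then f i else 0)
        split_ifs <;> simp }
    1 fun f => by
      rw [one_mul]
      refine lp.norm_mono (by norm_num) fun i => ?_
      change ‖if i ∈ s then f i else 0‖ ≤ ‖f i‖
      split_ifs <;> simp

open Classical in
lemma truncate_apply (s : Set I) (f : L2 I) (i : I) :
    truncate s f i = if i ∈ s then f i else 0 := rfl

lemma norm_truncate_sq (s : Set I) (f : L2 I) :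
    ‖truncate s f‖ ^ 2 = ∑' i : s, ‖f i‖ ^ 2 := by
  classical
  have h := lp.norm_rpow_eq_tsum (by norm_num : 0 < (2 : ENNReal).toReal) (truncate s f)
  simp only [ENNReal.toReal_ofNat, Real.rpow_ofNat] at h
  rw [h, tsum_subtype s fun i => ‖f i‖ ^ 2]
  congr 1
  funext i
  rw [truncate_apply, Set.indicator_apply]
  split_ifs <;> simp

end Coordinates

/-! ### Generated von Neumann algebras -/

section GeneratedBy

variable {E : Type*} [NormedAddCommGroup E] [InnerProductSpace ℂ E] [CompleteSpace E]
  {S T : Set (E →L[ℂ] E)}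

lemma subset_generatedBy (S : Set (E →L[ℂ] E)) : S ⊆ generatedBy S := by
  rw [coe_generatedBy]
  exact Set.subset_union_left.trans Set.subset_centralizer_centralizer

lemma generatedBy_le_of_subset (h : S ⊆ generatedBy T) : generatedBy S ≤ generatedBy T := by
  change (generatedBy S : Set (E →L[ℂ] E)) ⊆ generatedBy T
  have h' : S ∪ star S ⊆ generatedBy T := by
    refine Set.union_subset h fun x hx => ?_
    have := star_mem (S := VonNeumannAlgebra E) (h hx)
    simpa using this
  rw [coe_generatedBy S]
  rw [coe_generatedBy T] at h' ⊢
  have := Set.centralizer_subset (Set.centralizer_subset h')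
  rwa [Set.centralizer_centralizer_centralizer] at this

lemma mem_generatedBy_iff (hS : star S = S) {x : E →L[ℂ] E} :
    x ∈ generatedBy S ↔ ∀ y, (∀ a ∈ S, a * y = y * a) → y * x = x * y := by
  rw [← SetLike.mem_coe, coe_generatedBy, hS, Set.union_self]
  rfl

/-- A unitary that maps a self-adjoint set into itself by conjugation does the same to the von
Neumann algebra generated by this set. -/
lemma conj_mem_generatedBy (hS : star S = S) {u : E →L[ℂ] E} (hu : u ∈ unitary (E →L[ℂ] E))
    (huS : ∀ a ∈ S, u * a * star u ∈ S) {x : E →L[ℂ] E} (hx : x ∈ generatedBy S) :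
    u * x * star u ∈ generatedBy S := by
  have h1 : star u * u = 1 := (Unitary.mem_iff.1 hu).1
  have h2 : u * star u = 1 := (Unitary.mem_iff.1 hu).2
  rw [mem_generatedBy_iff hS] at hx ⊢
  intro y hy
  have hxy := hx (star u * y * u) fun a ha => by
    calc a * (star u * y * u) = (star u * u) * a * (star u * y * u) := by rw [h1, one_mul]
      _ = star u * (u * a * star u * y) * u := by simp only [mul_assoc]
      _ = star u * y * u * a * (star u * u) := by rw [hy _ (huS a ha)]; simp only [mul_assoc]
      _ = star u * y * u * a := by rw [h1, mul_one]
  calc y * (u * x * star u) = (u * star u) * y * (u * x * star u) := by rw [h2, one_mul]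
    _ = u * (star u * y * u * x) * star u := by simp only [mul_assoc]
    _ = u * x * star u * y * (u * star u) := by rw [hxy]; simp only [mul_assoc]
    _ = u * x * star u * y := by rw [h2, mul_one]

end GeneratedBy

/-! ### Fourier coefficients and the normalizer of L(H) -/

section GroupAlgebra

variable {G : Type*} [Group G] {H : Subgroup G}

lemma leftReg_apply (g : G) (f : L2 G) (x : G) : leftReg g f x = f (g⁻¹ * x) := by
  change ((1 : Circle) : ℂ) * f (g⁻¹ * x) = _
  simp

lemma leftReg_mul (g h : G) : leftReg (g * h) = leftReg g * leftReg h :=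
  clm_ext_basisVec fun x => by simp [leftReg_basisVec, mul_assoc]

lemma leftReg_one : leftReg (1 : G) = 1 :=
  clm_ext_basisVec fun x => by simp [leftReg_basisVec]

lemma star_leftReg (g : G) : star (leftReg g) = leftReg g⁻¹ := by
  classical
  refine clm_ext_basisVec fun x => ?_
  ext y
  rw [star_apply_basisVec, leftReg_basisVec, leftReg_basisVec, basisVec_apply, basisVec_apply]
  by_cases h : x = g * y
  · simp [h]
  · have h' : y ≠ g⁻¹ * x := fun h' => h (by simp [h'])
    simp [h, h']

lemma leftReg_mem_unitary (g : G) : leftReg g ∈ unitary (L2 G →L[ℂ] L2 G) := by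
  rw [Unitary.mem_iff, star_leftReg, ← leftReg_mul, ← leftReg_mul]
  simp [leftReg_one]

lemma star_leftReg_image (K : Subgroup G) :
    star (leftReg '' (K : Set G)) = leftReg '' (K : Set G) := by
  have h : ∀ a ∈ leftReg '' (K : Set G), star a ∈ leftReg '' (K : Set G) := by
    rintro _ ⟨k, hk, rfl⟩
    exact ⟨k⁻¹, inv_mem hk, (star_leftReg k).symm⟩
  refine Set.Subset.antisymm (fun a ha => ?_) fun a ha => h a ha
  have := h _ ha
  rwa [star_star] at this

lemma groupVN_eq : groupVN G = subgroupVN (⊤ : Subgroup G) := by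
  simp [groupVN, subgroupVN]

lemma leftReg_mem_vnNormalizer {n : G} (hn : n ∈ Subgroup.normalizer (H : Set G)) :
    leftReg n ∈ vnNormalizer (groupVN G) (subgroupVN H) := by
  have aux {n : G} (hn : n ∈ Subgroup.normalizer (H : Set G)) {a : L2 G →L[ℂ] L2 G}
      (ha : a ∈ subgroupVN H) : leftReg n * a * star (leftReg n) ∈ subgroupVN H := by
    refine conj_mem_generatedBy (star_leftReg_image H) (leftReg_mem_unitary n) ?_ ha
    rintro _ ⟨h, hh, rfl⟩
    exact ⟨n * h * n⁻¹, (Subgroup.mem_normalizer_iff.1 hn h).1 hh, by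
      rw [star_leftReg, leftReg_mul, leftReg_mul]⟩
  refine ⟨subset_generatedBy _ ⟨n, rfl⟩, leftReg_mem_unitary n, Set.Subset.antisymm ?_ ?_⟩
  · rintro _ ⟨a, ha, rfl⟩
    exact aux hn ha
  · intro a ha
    refine ⟨_, aux (inv_mem hn) ha, ?_⟩
    change leftReg n * (leftReg n⁻¹ * a * star (leftReg n⁻¹)) * star (leftReg n) = a
    rw [star_leftReg, star_leftReg, inv_inv, mul_assoc, mul_assoc, ← leftReg_mul, mul_inv_cancel,
      leftReg_one, mul_one, ← mul_assoc, ← leftReg_mul, mul_inv_cancel, leftReg_one, one_mul]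

/-- Elements of L(G) commute with the right translation δ_z ↦ δ_{zy}, so their matrices are
determined by the image of δ_1, the Fourier coefficients. -/
lemma mem_groupVN_apply_basisVec {u : L2 G →L[ℂ] L2 G} (hu : u ∈ groupVN G) (x y : G) :
    u (basisVec y) x = u (basisVec 1) (x * y⁻¹) := by
  set r : L2 G →L[ℂ] L2 G :=
    ((monomial (Equiv.mulRight y) fun _ => 1).toContinuousLinearEquiv : L2 G →L[ℂ] L2 G) with hr
  have hr_basis (z : G) : r (basisVec z) = basisVec (z * y) := by
    have h := monomial_basisVec (Equiv.mulRight y) (fun _ => 1) z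
    rw [Circle.coe_one, one_smul] at h
    exact h
  have hr_apply (f : L2 G) (z : G) : r f z = f (z * y⁻¹) := by
    change ((1 : Circle) : ℂ) * f (z * y⁻¹) = _
    simp
  rw [groupVN_eq, subgroupVN, mem_generatedBy_iff (star_leftReg_image _)] at hu
  have hcomm := hu r (by
    rintro _ ⟨g, -, rfl⟩
    exact clm_ext_basisVec fun z => by simp [hr_basis, leftReg_basisVec, mul_assoc])
  have := congrArg (fun T : L2 G →L[ℂ] L2 G => T (basisVec 1) x) hcomm
  simp only [mul_apply_eq_comp, hr_basis, one_mul, hr_apply] at this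
  exact this.symm

/-- An element of `L(G)` whose Fourier coefficients are supported on a subgroup `K` belongs to
`L(K)`. -/
lemma mem_subgroupVN_of_support {K : Subgroup G} {u : L2 G →L[ℂ] L2 G} (hu : u ∈ groupVN G)
    (hK : ∀ x, u (basisVec 1) x ≠ 0 → x ∈ K) : u ∈ subgroupVN K := by
  rw [subgroupVN, mem_generatedBy_iff (star_leftReg_image K)]
  intro T hT
  refine clm_ext_basisVec fun y => ?_
  ext x
  have h1 := hasSum_clm_apply T (u (basisVec y)) x
  have h2 := hasSum_clm_apply u (T (basisVec y)) x
  -- The substitutions i = gy and i = g⁻¹x attach to each term of both sums the same Fourier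
  -- coefficient u_g. For g in K the terms agree because T commutes with λ(g); for other g they
  -- vanish.
  rw [← (Equiv.mulRight y).hasSum_iff] at h1
  rw [← ((Equiv.inv G).trans (Equiv.mulRight x)).hasSum_iff] at h2
  refine h1.unique ?_
  refine (congrArg (fun F => HasSum F _) (funext fun g => ?_)).mpr h2
  simp only [Function.comp_apply, Equiv.trans_apply, Equiv.inv_apply, Equiv.coe_mulRight]
  rw [mem_groupVN_apply_basisVec hu x, mem_groupVN_apply_basisVec hu (g * y) y,
    mul_inv_cancel_right, show x * (g⁻¹ * x)⁻¹ = g by group]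
  by_cases hg : u (basisVec 1) g = 0
  · simp [hg]
  · have := congrArg (fun S : L2 G →L[ℂ] L2 G => S (basisVec y) x)
      (hT _ ⟨g, hK g hg, rfl⟩)
    simp only [mul_apply_eq_comp, leftReg_basisVec, leftReg_apply] at this
    rw [← this, mul_comm]

/-- For a unitary `u` normalizing `L(H)`, the mass of `u δ_1` on a coset `xH` is invariant under
the left action of `H`. -/
lemma tsum_coset_mul_left {u : L2 G →L[ℂ] L2 G}
    (hu : u ∈ vnNormalizer (groupVN G) (subgroupVN H)) {k : G} (hk : k ∈ H) (x : G) :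
    ∑' h : H, ‖u (basisVec 1) (k * x * h)‖ ^ 2 = ∑' h : H, ‖u (basisVec 1) (x * h)‖ ^ 2 := by
  obtain ⟨huM, huU, huA⟩ := hu
  have h1 : star u * u = 1 := (Unitary.mem_iff.1 huU).1
  -- The coordinate of u*δ_x at h is the conjugate of the Fourier coefficient at xh⁻¹, so the coset
  -- mass is the squared norm of the projection of u*δ_x to ℓ²(H).
  have mass (x : G) : ‖truncate (H : Set G) (star u (basisVec x))‖ ^ 2 =
      ∑' h : H, ‖u (basisVec 1) (x * h)‖ ^ 2 := by
    rw [norm_truncate_sq, ← (Equiv.inv H).tsum_eq]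
    refine tsum_congr fun h => ?_
    rw [star_apply_basisVec, mem_groupVN_apply_basisVec huM]
    simp
  obtain ⟨b, hb, hbk⟩ : leftReg k ∈ (fun a : L2 G →L[ℂ] L2 G => u * a * star u) ''
      (subgroupVN H : Set (L2 G →L[ℂ] L2 G)) := by
    rw [huA]
    exact subset_generatedBy _ ⟨k, hk, rfl⟩
  have hbu : star u * leftReg k = b * star u := by
    rw [← hbk]
    simp only [← mul_assoc, h1, one_mul]
  have hb' : b = star u * leftReg k * u := by rw [hbu, mul_assoc, h1, mul_one]
  have hbU : b ∈ unitary (L2 G →L[ℂ] L2 G) :=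
    hb' ▸ mul_mem (mul_mem (Unitary.star_mem huU) (leftReg_mem_unitary k)) huU
  -- The projection onto ℓ²(H) commutes with λ(H), hence with b in the bicommutant L(H); as b is
  -- unitary, it preserves the projected norm.
  have hcomm : truncate (H : Set G) * b = b * truncate (H : Set G) := by
    refine (mem_generatedBy_iff (star_leftReg_image H)).1 hb _ ?_
    rintro _ ⟨h, hh, rfl⟩
    ext f y
    simp only [mul_apply_eq_comp, leftReg_apply, truncate_apply]
    have hy : h⁻¹ * y ∈ (H : Set G) ↔ y ∈ (H : Set G) :=
      Subgroup.mul_mem_cancel_left H (inv_mem hh)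
    by_cases hyH : y ∈ (H : Set G)
    · rw [if_pos (hy.2 hyH), if_pos hyH]
    · rw [if_neg (mt hy.1 hyH), if_neg hyH]
  have h2 : star u (basisVec (k * x)) = b (star u (basisVec x)) := by
    rw [← leftReg_basisVec]
    exact DFunLike.congr_fun hbu (basisVec x)
  have h3 : truncate (H : Set G) (b (star u (basisVec x))) =
      b (truncate (H : Set G) (star u (basisVec x))) :=
    DFunLike.congr_fun hcomm (star u (basisVec x))
  rw [← mass, ← mass, h2, h3, ContinuousLinearMap.norm_map_of_mem_unitary hbU]

lemma vnNormalizer_subset (hH : ∀ x ∈ H, ∀ y ∈ H, x * y = y * x)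
    (hICC : ∀ g : G, g ∉ H → {x : G | ∃ h ∈ H, x = h * g * h⁻¹}.Infinite) :
    vnNormalizer (groupVN G) (subgroupVN H) ⊆
      subgroupVN (Subgroup.normalizer (H : Set G)) := by
  intro u hu
  obtain ⟨C, hC, -⟩ := H.exists_isComplement_left 1
  refine mem_subgroupVN_of_support hu.1 fun x hx => ?_
  have hsum : Summable fun p : C × H => ‖u (basisVec 1) (p.1 * p.2)‖ ^ 2 := by
    have := hC.equiv.symm.summable_iff.2 (summable_norm_sq (u (basisVec 1)))
    exact this.congr fun p => by simp [← hC.equiv_symm_apply]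
  have hx' : 0 < ∑' h : H, ‖u (basisVec 1) (sigma hC x * h)‖ ^ 2 := by
    refine (hsum.prod_factor (sigma hC x)).tsum_pos (fun h => by positivity) (eta hC x) ?_
    simp only [sigma_mul_eta]
    positivity
  have := mem_normalizer_of_summable hC hH hICC
    (w := fun c => ∑' h : H, ‖u (basisVec 1) (c * h)‖ ^ 2) hsum.prod (fun k hk c => ?_) hx'
  · rw [← sigma_mul_eta hC x]
    exact mul_mem this (Subgroup.le_normalizer (eta hC x).2)
  -- The representative σ(kc) differs from kc by η(kc) in H, which is absorbed by translating the
  -- summation over H.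
  · rw [← tsum_coset_mul_left hu hk c, ← (Equiv.mulLeft (eta hC (k * c))).tsum_eq fun h : H =>
        ‖u (basisVec 1) (sigma hC (k * c) * h)‖ ^ 2]
    refine tsum_congr fun h => ?_
    rw [Equiv.coe_mulLeft, Subgroup.coe_mul, ← mul_assoc, sigma_mul_eta]

end GroupAlgebra

end MasaGroup

end

theorem proposition3p1 {G : Type*} [Group G] [Countable G] (H : Subgroup G)
    (hH : ∀ x ∈ H, ∀ y ∈ H, x * y = y * x)
    (hICC : ∀ g : G, g ∉ H → {x : G | ∃ h ∈ H, x = h * g * h⁻¹}.Infinite) :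
    (∀ (C : Set G) (hC : Subgroup.IsComplement C (H : Set G)), (1 : G) ∈ C →
      ∀ s t : H →* Circle,
        (MasaGroup.UnitarilyEquivalent (MasaGroup.inducedRep hC s) (MasaGroup.inducedRep hC t) ↔
          MasaGroup.UnitarilyEquivalent ((MasaGroup.inducedRep hC s).comp H.subtype)
            ((MasaGroup.inducedRep hC t).comp H.subtype))) ∧
    MasaGroup.generatedBy
        (MasaGroup.leftReg '' (Subgroup.normalizer (H : Set G) : Set G)) =
      MasaGroup.generatedBy
        (MasaGroup.vnNormalizer (MasaGroup.groupVN G) (MasaGroup.subgroupVN H)) := by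
  open MasaGroup in
  refine ⟨fun C hC h1 s t => ⟨?_, fun h => ?_⟩, le_antisymm ?_ ?_⟩
  · rintro ⟨U, hU⟩
    exact ⟨U, fun k => hU k⟩
  · obtain ⟨n, hn, hst⟩ := exists_conj_of_unitarilyEquivalent hC hH hICC h1 h
    exact unitarilyEquivalent_inducedRep_of_conj hC hn hst
  · refine generatedBy_le_of_subset (Set.Subset.trans ?_ (subset_generatedBy _))
    rintro _ ⟨n, hn, rfl⟩
    exact leftReg_mem_vnNormalizer hn
  · exact generatedBy_le_of_subset (vnNormalizer_subset hH hICC)
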